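/- Let $\Sigma$ be an immersed surface in $\mathbb{R}^3$ of class $C^2$, possibly with boundary, given by an immersion $F:M\to\mathbb{R}^3$ of a $2$-manifold $M$ (an embedded surface is the case where $F$ is an inclusion). A curve on $\Sigma$ is a $C^1$ curve $\gamma:[a,b]\to M$, $a<b$; it is called real-analytic if $F\circ\gamma$ is real-analytic on $[a,b]$, end points included, with nowhere vanishing derivative (closed curves, $\gamma(a)=\gamma(b)$, and self-intersections are allowed). The curve $\gamma$ is a line of curvature if its tangent is a principal direction at each of its points; the principal curvature along it is the one in this direction. It has constant geodesic curvature $c\in\mathbb{R}$ if $\langle \frac{dT}{ds},N\times T\rangle=c$ along $\gamma$ for some continuous unit normal field $N$ of $\Sigma$ along $\gamma$, where $T$ is the unit tangent of $F\circ\gamma$ and $s$ its arc length. (1) Let $\Gamma=\gamma([a,b])$ be a real-analytic curve on $\Sigma$ which is a line of curvature, such that the principal curvature along $\Gamma$ vanishes at only finitely many points, and which has constant geodesic curvature $c$. If $c\neq0$, there is a sphere $S\subset\mathbb{R}^3$ of radius $1/|c|$ that contains $F(\Gamma)$ and meets $\Sigma$ orthogonally along $\Gamma$ (at every point of $\Gamma$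 the tangent planes of $\Sigma$ and $S$ are perpendicular). If $c=0$, the same holds with a plane $S$. (2) Let $\gamma:[t_0,t_n]\to M$ be continuous and piecewise real-analytic, i.e. $n\ge1$ and there are $t_0<t_1<\dots<t_n$ such that each $\Gamma_i=\gamma([t_{i-1},t_i])$, $1\le i\le n$, is a real-analytic curve on $\Sigma$. Suppose that each $\Gamma_i$ is a line of curvature whose principal curvature vanishes at only finitely many points, and has constant geodesic curvature $c$, with the same $c$ for all $i$. If $c\ne0$, there are spheres $S_1,\dots,S_n$ of radius $1/|c|$ such that, for every $i$, $S_i$ contains $F(\Gamma_i)$ and meets $\Sigma$ orthogonally along $\Gamma_i$; so $\Sigma$ meets the union $S_1\cup\dots\cup S_n$ orthogonally along $\Gamma=\Gamma_1\cup\dots\cup\Gamma_n$. If $c=0$, the same holds with planes $S_1,\dots,S_n$. -/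

import Mathlib

open Set Topology
open scoped Manifold ContDiff InnerProductSpace

noncomputable section

namespace SurfaceCurve

/-- Euclidean plane, the model of surfaces. -/
abbrev E2 : Type := EuclideanSpace ℝ (Fin 2)

/-- Euclidean three-space. -/
abbrev E3 : Type := EuclideanSpace ℝ (Fin 3)

/-- The vector product of `ℝ³`. -/
def cross (u v : E3) : E3 :=
  WithLp.toLp 2 (crossProduct (WithLp.ofLp u) (WithLp.ofLp v))

section Surface

variable {H : Type*} [TopologicalSpace H] (I : ModelWithCorners ℝ E2 H)
  {M : Type*} [TopologicalSpace M] [ChartedSpace H M]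

/-- The differential at `p` of a map from the surface to `ℝ³`. -/
def differential (f : M → E3) (p : M) : TangentSpace I p →L[ℝ] E3 :=
  mfderiv I 𝓘(ℝ, E3) f p

/-- `F : M → ℝ³` is an immersed surface of class `C²`; it may have a boundary, since the model `I`
may be the plane, the half-plane or the quadrant. -/
structure IsSurfaceImmersion (F : M → E3) : Prop where
  contMDiff : ContMDiff I 𝓘(ℝ, E3) 2 F
  injective_differential : ∀ p : M, Function.Injective (differential I F p)

/-- The tangent plane of the surface at `p`, as a linear subspace of `ℝ³`. -/
def tangentPlane (F : M → E3) (p : M) : Submodule ℝ E3 :=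
  LinearMap.range (differential I F p).toLinearMap

/-- `n` is one of the two unit normal vectors of the surface at `p`. -/
def IsUnitNormalAt (F : M → E3) (p : M) (n : E3) : Prop :=
  ‖n‖ = 1 ∧ n ∈ (tangentPlane I F p)ᗮ

/-- `ν` is, near `p`, a `C¹` field of unit normals of the surface (a local Gauss map). -/
def IsGaussMapNear (F ν : M → E3) (p : M) : Prop :=
  ContMDiffAt I 𝓘(ℝ, E3) 1 ν p ∧ ∀ᶠ q in 𝓝 p, IsUnitNormalAt I F q (ν q)

/-- First fundamental form. -/
def firstForm (F : M → E3) (p : M) (v w : TangentSpace I p) : ℝ :=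
  ⟪differential I F p v, differential I F p w⟫_ℝ

/-- Second fundamental form with respect to the Gauss map `ν`. -/
def secondForm (F ν : M → E3) (p : M) (v w : TangentSpace I p) : ℝ :=
  -⟪differential I ν p v, differential I F p w⟫_ℝ

/-- `v` is a principal direction at `p` with principal curvature `k`: a nonzero eigenvector, with
eigenvalue `k`, of the second fundamental form relative to the first one, i.e. of the shape
operator. The number `k` is determined by `v` up to the sign that comes from the choice of one of
the two local Gauss maps. -/
def IsPrincipal (F : M → E3) (p : M) (v : TangentSpace I p) (k : ℝ) : Prop :=
  v ≠ 0 ∧ ∃ ν : M → E3, IsGaussMapNear I F ν p ∧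
    ∀ w : TangentSpace I p, secondForm I F ν p v w = k * firstForm I F p v w

/-- The velocity in the surface of the curve `γ : [a, b] → M` (one-sided at the end points). -/
def velocity (γ : ℝ → M) (a b t : ℝ) : TangentSpace I (γ t) :=
  mfderivWithin 𝓘(ℝ, ℝ) I γ (Icc a b) t (1 : ℝ)

/-- `γ : [a, b] → M` is a curve on the surface whose trace in `ℝ³` is a regular real-analytic curve,
up to and including the end points. A closed curve is the case `γ a = γ b`. -/
structure IsAnalyticCurve (F : M → E3) (γ : ℝ → M) (a b : ℝ) : Prop where
  lt : a < b
  contMDiffOn : ContMDiffOn 𝓘(ℝ, ℝ) I 1 γ (Icc a b)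
  analyticOn : AnalyticOn ℝ (F ∘ γ) (Icc a b)
  regular : ∀ t ∈ Icc a b, derivWithin (F ∘ γ) (Icc a b) t ≠ 0

/-- The continuous curve `γ : [t 0, t n] → M` is piecewise real-analytic, with break points
`t 0 < t 1 < ⋯ < t n`. -/
structure IsPiecewiseAnalyticCurve (F : M → E3) (γ : ℝ → M) {n : ℕ} (t : Fin (n + 1) → ℝ) :
    Prop where
  pos : 0 < n
  strictMono : StrictMono t
  continuousOn : ContinuousOn γ (Icc (t 0) (t (Fin.last n)))
  piece : ∀ i : Fin n, IsAnalyticCurve I F γ (t i.castSucc) (t i.succ)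

/-- The tangent of `γ` is a principal direction at all of its points. -/
def IsLineOfCurvature (F : M → E3) (γ : ℝ → M) (a b : ℝ) : Prop :=
  ∀ t ∈ Icc a b, ∃ k : ℝ, IsPrincipal I F (γ t) (velocity I γ a b t) k

/-- The points of the line of curvature `γ` at which the principal curvature in the direction of
`γ` vanishes. -/
def flatPoints (F : M → E3) (γ : ℝ → M) (a b : ℝ) : Set M :=
  γ '' {t ∈ Icc a b | IsPrincipal I F (γ t) (velocity I γ a b t) 0}

/-- The unit tangent vector in `ℝ³` of a curve `α : [a, b] → ℝ³`. -/
def unitTangent (α : ℝ → E3) (a b t : ℝ) : E3 :=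
  ‖derivWithin α (Icc a b) t‖⁻¹ • derivWithin α (Icc a b) t

/-- The geodesic curvature `⟨dT/ds, N × T⟩` of the curve `α : [a, b] → ℝ³` on a surface with unit
normal `N` along `α`; here `T` is the unit tangent and `s` is the arc length. -/
def geodesicCurvature (α N : ℝ → E3) (a b t : ℝ) : ℝ :=
  ⟪‖derivWithin α (Icc a b) t‖⁻¹ • derivWithin (unitTangent α a b) (Icc a b) t,
    cross (N t) (unitTangent α a b t)⟫_ℝ

/-- The curve `γ : [a, b] → M` has constant geodesic curvature `c` on the surface, with respect to
one of the two continuous choices of the unit normal along it. -/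
def HasConstGeodesicCurvature (F : M → E3) (γ : ℝ → M) (a b c : ℝ) : Prop :=
  ∃ N : ℝ → E3, ContinuousOn N (Icc a b) ∧ (∀ t ∈ Icc a b, IsUnitNormalAt I F (γ t) (N t)) ∧
    ∀ t ∈ Icc a b, geodesicCurvature (F ∘ γ) N a b t = c

/-- Two planes through the origin meet at a right angle: their normals are perpendicular. -/
def PerpPlanes (U V : Submodule ℝ E3) : Prop :=
  Uᗮ ⟂ Vᗮ

/-- The surface meets the sphere with centre `O` and radius `r` orthogonally along `Γ`: the sphere
contains `Γ`, and at the points of `Γ` the tangent plane of the surface is perpendicular to that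
of the sphere. -/
def MeetsSphereOrthogonally (F : M → E3) (Γ : Set M) (O : E3) (r : ℝ) : Prop :=
  ∀ p ∈ Γ, F p ∈ Metric.sphere O r ∧ PerpPlanes (tangentPlane I F p) (ℝ ∙ (F p - O))ᗮ

/-- `P` is a plane of `ℝ³`, and the surface meets it orthogonally along `Γ`. -/
def MeetsPlaneOrthogonally (F : M → E3) (Γ : Set M) (P : AffineSubspace ℝ E3) : Prop :=
  Module.finrank ℝ P.direction = 2 ∧
    ∀ p ∈ Γ, F p ∈ P ∧ PerpPlanes (tangentPlane I F p) P.direction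

end Surface

end SurfaceCurve

end

open Set Topology
open scoped Manifold ContDiff InnerProductSpace

namespace SurfaceCurve

/-! Write `α = F ∘ γ` and let `V = N × T` be the conormal. Everything rests on `V' = -c α'`
(`hasDerivWithinAt_conormal`), read off in the orthonormal frame `N, T, V`. The `V`-component of
`V'` vanishes because `|V| = 1`. The `N`-component is `-⟪V, N'⟫`, zero because `T` is principal. The
`T`-component is `-⟪V, T'⟫ = -c ‖α'‖` by definition of geodesic curvature. Hence `V + c α` is
constant (`exists_conormal`). For `c ≠ 0` this constant divided by `c` is the centre of the sphere,
and the radius vector `-V / c` is tangent to the surface. For `c = 0` the vector `V` is constant and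
normal to a plane containing the curve. Piecewise curves are treated piece by piece. -/

/-! ### Vector algebra in `ℝ³`. -/

lemma inner_eq_sum (u v : E3) : ⟪u, v⟫_ℝ = u 0 * v 0 + u 1 * v 1 + u 2 * v 2 := by
  simp [PiLp.inner_apply, Fin.sum_univ_three, mul_comm]

lemma cross_zero (u v : E3) : cross u v 0 = u 1 * v 2 - u 2 * v 1 := by
  simp [cross, crossProduct]

lemma cross_one (u v : E3) : cross u v 1 = u 2 * v 0 - u 0 * v 2 := by
  simp [cross, crossProduct]

lemma cross_two (u v : E3) : cross u v 2 = u 0 * v 1 - u 1 * v 0 := by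
  simp [cross, crossProduct]

lemma inner_left_cross (u v : E3) : ⟪u, cross u v⟫_ℝ = 0 := by
  rw [inner_eq_sum, cross_zero, cross_one, cross_two]; ring

lemma inner_right_cross (u v : E3) : ⟪v, cross u v⟫_ℝ = 0 := by
  rw [inner_eq_sum, cross_zero, cross_one, cross_two]; ring

/-- Lagrange's identity. -/
lemma inner_cross_cross (u v : E3) :
    ⟪cross u v, cross u v⟫_ℝ = ⟪u, u⟫_ℝ * ⟪v, v⟫_ℝ - ⟪u, v⟫_ℝ ^ 2 := by
  simp only [inner_eq_sum, cross_zero, cross_one, cross_two]; ring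

lemma norm_cross_of_orthonormal {u v : E3} (hu : ‖u‖ = 1) (hv : ‖v‖ = 1)
    (huv : ⟪u, v⟫_ℝ = 0) : ‖cross u v‖ = 1 := by
  have h := inner_cross_cross u v
  rw [real_inner_self_eq_norm_sq, real_inner_self_eq_norm_sq, real_inner_self_eq_norm_sq,
    hu, hv, huv] at h
  have h' : ‖cross u v‖ ^ 2 = 1 := by linarith
  exact (pow_eq_one_iff_of_nonneg (norm_nonneg _) two_ne_zero).1 h'

/-- The vector triple product expansion. -/
lemma cross_cross (w u v : E3) :
    cross w (cross u v) = ⟪w, v⟫_ℝ • u - ⟪w, u⟫_ℝ • v := by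
  ext i
  fin_cases i <;>
    simp [inner_eq_sum, cross_zero, cross_one, cross_two] <;> ring

/-- A vector perpendicular to an orthonormal frame `u, v, u × v` vanishes. -/
lemma eq_zero_of_inner_frame {u v w : E3} (hu : ‖u‖ = 1) (hv : ‖v‖ = 1) (huv : ⟪u, v⟫_ℝ = 0)
    (h1 : ⟪w, u⟫_ℝ = 0) (h2 : ⟪w, v⟫_ℝ = 0) (h3 : ⟪w, cross u v⟫_ℝ = 0) : w = 0 := by
  -- By the triple product expansion `w × (u × v) = 0`, so Lagrange's identity reduces to `0 =
  -- ‖w‖²`.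
  have h := inner_cross_cross w (cross u v)
  rw [cross_cross, h1, h2, h3, real_inner_self_eq_norm_sq (cross u v),
    norm_cross_of_orthonormal hu hv huv] at h
  rw [← inner_self_eq_zero (𝕜 := ℝ)]
  simpa using h.symm

lemma differentiableWithinAt_cross {u v : ℝ → E3} {s : Set ℝ} {t : ℝ}
    (hu : DifferentiableWithinAt ℝ u s t) (hv : DifferentiableWithinAt ℝ v s t) :
    DifferentiableWithinAt ℝ (fun x => cross (u x) (v x)) s t := by
  have hu' := differentiableWithinAt_euclidean.1 hu
  have hv' := differentiableWithinAt_euclidean.1 hv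
  refine differentiableWithinAt_euclidean.2 fun i => ?_
  fin_cases i
  · exact (((hu' 1).mul (hv' 2)).sub ((hu' 2).mul (hv' 1))).congr (fun x _ => cross_zero _ _)
      (cross_zero _ _)
  · exact (((hu' 2).mul (hv' 0)).sub ((hu' 0).mul (hv' 2))).congr (fun x _ => cross_one _ _)
      (cross_one _ _)
  · exact (((hu' 0).mul (hv' 1)).sub ((hu' 1).mul (hv' 0))).congr (fun x _ => cross_two _ _)
      (cross_two _ _)

/-- If `u ⟂ v` along a curve, then `⟨u', v⟩ = -⟨u, v'⟩`. -/
lemma inner_deriv_add_eq_zero {u v : ℝ → E3} {u' v' : E3} {a b t d : ℝ} (hab : a < b)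
    (ht : t ∈ Icc a b) (hu : HasDerivWithinAt u u' (Icc a b) t)
    (hv : HasDerivWithinAt v v' (Icc a b) t) (h : ∀ x ∈ Icc a b, ⟪u x, v x⟫_ℝ = d) :
    ⟪u t, v'⟫_ℝ + ⟪u', v t⟫_ℝ = 0 := by
  have h1 := hu.inner ℝ hv
  have h2 : HasDerivWithinAt (fun x => ⟪u x, v x⟫_ℝ) 0 (Icc a b) t :=
    (hasDerivWithinAt_const t (Icc a b) d).congr h (h t ht)
  exact (uniqueDiffOn_Icc hab t ht).eq_deriv _ h1 h2

section Surface

variable {H : Type*} [TopologicalSpace H] {I : ModelWithCorners ℝ E2 H}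
  {M : Type*} [TopologicalSpace M] [ChartedSpace H M] {F : M → E3}

/-! ### Tangent planes and unit normals. -/

lemma finrank_tangentPlane (hF : IsSurfaceImmersion I F) (p : M) :
    Module.finrank ℝ (tangentPlane I F p) = 2 := by
  have h := LinearMap.finrank_range_of_inj (f := (differential I F p).toLinearMap)
    (hF.injective_differential p)
  exact h.trans (finrank_euclideanSpace_fin (𝕜 := ℝ) (n := 2))

/-- The tangent plane is the orthogonal complement of a unit normal. -/
lemma mem_tangentPlane_iff (hF : IsSurfaceImmersion I F) {p : M} {n : E3}
    (hn : IsUnitNormalAt I F p n) (v : E3) : v ∈ tangentPlane I F p ↔ ⟪n, v⟫_ℝ = 0 := by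
  have hn0 : n ≠ 0 := by
    rintro rfl
    simpa using hn.1
  have hle : tangentPlane I F p ≤ (ℝ ∙ n)ᗮ := fun w hw =>
    Submodule.mem_orthogonal_singleton_iff_inner_right.2
      (Submodule.inner_left_of_mem_orthogonal hw hn.2)
  have : Fact (Module.finrank ℝ E3 = 2 + 1) := ⟨by simp⟩
  have heq := Submodule.eq_of_le_of_finrank_eq hle
    ((finrank_tangentPlane hF p).trans (Submodule.finrank_orthogonal_span_singleton hn0).symm)
  rw [heq, Submodule.mem_orthogonal_singleton_iff_inner_right]

/-- The difference of the two sides is both normal and tangent to the surface. -/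
lemma unitNormal_eq_smul (hF : IsSurfaceImmersion I F) {p : M} {n m : E3}
    (hn : IsUnitNormalAt I F p n) (hm : IsUnitNormalAt I F p m) : m = ⟪n, m⟫_ℝ • n := by
  have h1 : m - ⟪n, m⟫_ℝ • n ∈ (tangentPlane I F p)ᗮ :=
    Submodule.sub_mem _ hm.2 (Submodule.smul_mem _ _ hn.2)
  have h2 : m - ⟪n, m⟫_ℝ • n ∈ tangentPlane I F p := by
    rw [mem_tangentPlane_iff hF hn, inner_sub_right, real_inner_smul_right,
      real_inner_self_eq_norm_sq, hn.1]
    ring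
  exact sub_eq_zero.1 (inner_self_eq_zero.1 (Submodule.inner_right_of_mem_orthogonal h2 h1))

lemma inner_unitNormal_eq (hF : IsSurfaceImmersion I F) {p : M} {n m : E3}
    (hn : IsUnitNormalAt I F p n) (hm : IsUnitNormalAt I F p m) :
    ⟪n, m⟫_ℝ = 1 ∨ ⟪n, m⟫_ℝ = -1 := by
  have h := congrArg norm (unitNormal_eq_smul hF hn hm)
  rw [norm_smul, hn.1, hm.1, mul_one, Real.norm_eq_abs] at h
  exact eq_or_eq_neg_of_abs_eq h.symm

lemma hasDerivWithinAt_comp_curve {γ : ℝ → M} {a b t : ℝ} {f : M → E3}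
    (hγ : ContMDiffOn 𝓘(ℝ, ℝ) I 1 γ (Icc a b)) (ht : t ∈ Icc a b)
    (hf : MDifferentiableAt I 𝓘(ℝ, E3) f (γ t)) :
    HasDerivWithinAt (f ∘ γ) (differential I f (γ t) (velocity I γ a b t)) (Icc a b) t := by
  have h1 := ((hγ t ht).mdifferentiableWithinAt one_ne_zero).hasMFDerivWithinAt
  have h2 : HasFDerivWithinAt (𝕜 := ℝ) (E := ℝ) (F := E3) (f ∘ γ) _ (Icc a b) t :=
    (hf.hasMFDerivAt.comp_hasMFDerivWithinAt t h1).hasFDerivWithinAt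
  exact h2.hasDerivWithinAt

/-- A continuous unit normal along a curve agrees, up to a constant sign, with any local Gauss
map; hence it is differentiable. -/
lemma hasDerivWithinAt_normal (hF : IsSurfaceImmersion I F) {γ : ℝ → M} {a b t : ℝ} {N : ℝ → E3}
    {ν : M → E3} (hγ : ContMDiffOn 𝓘(ℝ, ℝ) I 1 γ (Icc a b)) (ht : t ∈ Icc a b)
    (hN : ContinuousOn N (Icc a b)) (hNu : ∀ x ∈ Icc a b, IsUnitNormalAt I F (γ x) (N x))
    (hν : IsGaussMapNear I F ν (γ t)) :
    ∃ ε : ℝ, HasDerivWithinAt N (ε • differential I ν (γ t) (velocity I γ a b t))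
      (Icc a b) t := by
  have hd := hasDerivWithinAt_comp_curve hγ ht (hν.1.mdifferentiableAt one_ne_zero)
  have hγc : ContinuousWithinAt γ (Icc a b) t := (hγ t ht).continuousWithinAt
  have hev : ∀ᶠ x in 𝓝[Icc a b] t, IsUnitNormalAt I F (γ x) (ν (γ x)) :=
    hγc.eventually hν.2
  have hc : ContinuousWithinAt (fun x => ⟪(ν ∘ γ) x, N x⟫_ℝ) (Icc a b) t :=
    hd.continuousWithinAt.inner (𝕜 := ℝ) (hN t ht)
  have hmem : ∀ᶠ x in 𝓝[Icc a b] t, x ∈ Icc a b := self_mem_nhdsWithin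
  have hsign : ∀ᶠ x in 𝓝[Icc a b] t, ⟪(ν ∘ γ) x, N x⟫_ℝ = ⟪(ν ∘ γ) t, N t⟫_ℝ := by
    -- The inner product is continuous with values `±1`; staying within distance `1` of its value at
    -- `t`, it cannot change sign.
    have hclose := hc.eventually (Metric.ball_mem_nhds _ one_pos)
    filter_upwards [hclose, hev, hmem] with x hx hux hxm
    have h1 := inner_unitNormal_eq hF hux (hNu x hxm)
    have h2 := inner_unitNormal_eq hF (hν.2.self_of_nhds) (hNu t ht)
    rw [Real.dist_eq, abs_lt] at hx
    simp only [Function.comp_apply] at hx ⊢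
    rcases h1 with h1 | h1 <;> rcases h2 with h2 | h2 <;> rw [h1, h2] at hx ⊢ <;>
      norm_num at hx
  refine ⟨⟪(ν ∘ γ) t, N t⟫_ℝ, (hd.const_smul _).congr_of_eventuallyEq ?_ ?_⟩
  · filter_upwards [hsign, hev, hmem] with x hx hux hxm
    rw [Pi.smul_apply, ← hx]
    exact unitNormal_eq_smul hF hux (hNu x hxm)
  · exact unitNormal_eq_smul hF hν.2.self_of_nhds (hNu t ht)

/-! ### The conormal of a line of curvature. -/

variable {γ : ℝ → M} {a b c : ℝ}

lemma IsAnalyticCurve.hasDerivWithinAt (hF : IsSurfaceImmersion I F)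
    (hγ : IsAnalyticCurve I F γ a b) {t : ℝ} (ht : t ∈ Icc a b) :
    HasDerivWithinAt (F ∘ γ) (differential I F (γ t) (velocity I γ a b t)) (Icc a b) t :=
  hasDerivWithinAt_comp_curve hγ.contMDiffOn ht
    ((hF.contMDiff (γ t)).mdifferentiableAt two_ne_zero)

lemma IsAnalyticCurve.derivWithin_mem (hF : IsSurfaceImmersion I F)
    (hγ : IsAnalyticCurve I F γ a b) {t : ℝ} (ht : t ∈ Icc a b) :
    derivWithin (F ∘ γ) (Icc a b) t ∈ tangentPlane I F (γ t) := by
  rw [(hγ.hasDerivWithinAt hF ht).derivWithin (uniqueDiffOn_Icc hγ.lt t ht)]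
  exact ⟨_, rfl⟩

lemma IsAnalyticCurve.differentiableWithinAt_unitTangent
    (hγ : IsAnalyticCurve I F γ a b) {t : ℝ} (ht : t ∈ Icc a b) :
    DifferentiableWithinAt ℝ (unitTangent (F ∘ γ) a b) (Icc a b) t := by
  have hu := uniqueDiffOn_Icc hγ.lt
  have h2 : ContDiffOn ℝ 2 (F ∘ γ) (Icc a b) := hγ.analyticOn.contDiffOn hu
  have h1 : ContDiffOn ℝ 1 (derivWithin (F ∘ γ) (Icc a b)) (Icc a b) :=
    h2.derivWithin hu (by norm_num)
  have hd := h1.differentiableOn one_ne_zero t ht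
  exact ((hd.norm ℝ (hγ.regular t ht)).inv (norm_ne_zero_iff.2 (hγ.regular t ht))).smul hd

lemma IsAnalyticCurve.norm_unitTangent (hγ : IsAnalyticCurve I F γ a b) {t : ℝ}
    (ht : t ∈ Icc a b) : ‖unitTangent (F ∘ γ) a b t‖ = 1 := by
  rw [unitTangent, norm_smul, norm_inv, norm_norm,
    inv_mul_cancel₀ (norm_ne_zero_iff.2 (hγ.regular t ht))]

/-- Along a line of curvature of constant geodesic curvature `c`, the conormal `V = N × T`
satisfies `V' = -c α'`. -/
lemma hasDerivWithinAt_conormal (hF : IsSurfaceImmersion I F) (hγ : IsAnalyticCurve I F γ a b)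
    (hl : IsLineOfCurvature I F γ a b) {N : ℝ → E3} (hN : ContinuousOn N (Icc a b))
    (hNu : ∀ x ∈ Icc a b, IsUnitNormalAt I F (γ x) (N x))
    (hc : ∀ x ∈ Icc a b, geodesicCurvature (F ∘ γ) N a b x = c) {t : ℝ} (ht : t ∈ Icc a b) :
    HasDerivWithinAt (fun x => cross (N x) (unitTangent (F ∘ γ) a b x))
      (-(c • derivWithin (F ∘ γ) (Icc a b) t)) (Icc a b) t := by
  set T := unitTangent (F ∘ γ) a b
  have hα := hγ.hasDerivWithinAt hF ht
  have hαd := hα.derivWithin (uniqueDiffOn_Icc hγ.lt t ht)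
  have hNT : ∀ x ∈ Icc a b, ⟪N x, T x⟫_ℝ = 0 := fun x hx =>
    (mem_tangentPlane_iff hF (hNu x hx) _).1
      (Submodule.smul_mem _ _ (hγ.derivWithin_mem hF hx))
  have hVn : ∀ x ∈ Icc a b, ⟪cross (N x) (T x), cross (N x) (T x)⟫_ℝ = 1 := fun x hx => by
    rw [real_inner_self_eq_norm_sq,
      norm_cross_of_orthonormal (hNu x hx).1 (hγ.norm_unitTangent hx) (hNT x hx), one_pow]
  have hTd := (hγ.differentiableWithinAt_unitTangent ht).hasDerivWithinAt
  obtain ⟨k, -, ν, hν, hk⟩ := hl t ht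
  obtain ⟨ε, hNd⟩ := hasDerivWithinAt_normal hF hγ.contMDiffOn ht hN hNu hν
  have hVd := (differentiableWithinAt_cross hNd.differentiableWithinAt
    hTd.differentiableWithinAt).hasDerivWithinAt
  set α' := derivWithin (F ∘ γ) (Icc a b) t
  set V := cross (N t) (T t)
  set V' := derivWithin (fun x => cross (N x) (T x)) (Icc a b) t
  have hα'0 : ‖α'‖ ≠ 0 := norm_ne_zero_iff.2 (hγ.regular t ht)
  have hα'T : α' = ‖α'‖ • T t := by
    change α' = ‖α'‖ • (‖α'‖⁻¹ • α')
    rw [smul_inv_smul₀ hα'0]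
  have hVα' : ⟪V, α'⟫_ℝ = 0 := by
    rw [hα'T, real_inner_smul_right, real_inner_comm, inner_right_cross, mul_zero]
  -- the geodesic torsion of a line of curvature vanishes
  have hVν : ⟪V, differential I ν (γ t) (velocity I γ a b t)⟫_ℝ = 0 := by
    -- `V ⟂ N` is tangent, so it can serve as test vector in the eigenvalue equation, whose right
    -- side vanishes as `V ⟂ α'`.
    obtain ⟨w, hw⟩ := (mem_tangentPlane_iff hF (hNu t ht) V).2 (inner_left_cross _ _)
    have hw' : differential I F (γ t) w = V := hw
    have h := hk w
    rw [secondForm, firstForm, hw', ← hαd, real_inner_comm V α', hVα', mul_zero] at h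
    rw [real_inner_comm]
    linarith
  have e1 : ⟪V', N t⟫_ℝ = 0 := by
    have h := inner_deriv_add_eq_zero hγ.lt ht hVd hNd
      (fun x _ => by rw [real_inner_comm]; exact inner_left_cross _ _)
    rw [real_inner_smul_right, hVν] at h
    linarith
  have e2 : ⟪V', T t⟫_ℝ = -(c * ‖α'‖) := by
    have h := inner_deriv_add_eq_zero hγ.lt ht hVd hTd
      (fun x _ => by rw [real_inner_comm]; exact inner_right_cross _ _)
    have hg := hc t ht
    rw [geodesicCurvature, real_inner_smul_left, real_inner_comm] at hg
    -- The factor `‖α'‖` converts the arc length derivative into the parameter derivative.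
    have hg' : ⟪V, derivWithin T (Icc a b) t⟫_ℝ = c * ‖α'‖ := by
      rw [← hg, mul_right_comm, inv_mul_cancel₀ hα'0, one_mul]
    rw [hg'] at h
    linarith
  have e3 : ⟪V', V⟫_ℝ = 0 := by
    have h := inner_deriv_add_eq_zero hγ.lt ht hVd hVd hVn
    rw [real_inner_comm V' V] at h
    linarith
  have hzero : V' + c • α' = 0 := by
    have hTn : ‖T t‖ = 1 := hγ.norm_unitTangent ht
    refine eq_zero_of_inner_frame (hNu t ht).1 hTn (hNT t ht) ?_ ?_ ?_
    · rw [inner_add_left, e1, hα'T, real_inner_smul_left, real_inner_smul_left,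
        real_inner_comm, hNT t ht]
      simp
    · rw [inner_add_left, e2, hα'T, real_inner_smul_left, real_inner_smul_left,
        real_inner_self_eq_norm_sq, norm_smul, hTn, norm_norm]
      ring
    · rw [inner_add_left, e3, real_inner_smul_left, real_inner_comm, hVα']
      simp
  rwa [eq_neg_of_add_eq_zero_left hzero] at hVd

/-- Along a line of curvature of constant geodesic curvature `c` there is a unit tangent field `V`
of the surface such that `V + c α` is constant, and `V ⟂ α'`. -/
lemma exists_conormal (hF : IsSurfaceImmersion I F) (hγ : IsAnalyticCurve I F γ a b)
    (hl : IsLineOfCurvature I F γ a b) (hc : HasConstGeodesicCurvature I F γ a b c) :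
    ∃ V : ℝ → E3, (∀ t ∈ Icc a b, ‖V t‖ = 1 ∧ V t ∈ tangentPlane I F (γ t) ∧
      ⟪V t, derivWithin (F ∘ γ) (Icc a b) t⟫_ℝ = 0 ∧
      V t + c • F (γ t) = V a + c • F (γ a)) := by
  obtain ⟨N, hN, hNu, hg⟩ := hc
  refine ⟨fun x => cross (N x) (unitTangent (F ∘ γ) a b x), fun t ht => ⟨?_, ?_, ?_, ?_⟩⟩
  · exact norm_cross_of_orthonormal (hNu t ht).1 (hγ.norm_unitTangent ht)
      ((mem_tangentPlane_iff hF (hNu t ht) _).1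
        (Submodule.smul_mem _ _ (hγ.derivWithin_mem hF ht)))
  · exact (mem_tangentPlane_iff hF (hNu t ht) _).2 (inner_left_cross _ _)
  · have h := inner_right_cross (N t) (unitTangent (F ∘ γ) a b t)
    nth_rw 1 [unitTangent] at h
    rw [real_inner_smul_left] at h
    rw [real_inner_comm]
    exact (mul_eq_zero.1 h).resolve_left (inv_ne_zero (norm_ne_zero_iff.2 (hγ.regular t ht)))
  · have hd : ∀ x ∈ Icc a b, HasDerivWithinAt
        (fun x => cross (N x) (unitTangent (F ∘ γ) a b x) + c • (F ∘ γ) x) 0 (Icc a b) x := by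
      intro x hx
      have h := (hasDerivWithinAt_conormal hF hγ hl hN hNu hg hx).add
        (((hγ.hasDerivWithinAt hF hx).differentiableWithinAt.hasDerivWithinAt).const_smul c)
      rwa [neg_add_cancel] at h
    exact constant_of_derivWithin_zero (fun x hx => (hd x hx).differentiableWithinAt)
      (fun x hx => (hd x (Ico_subset_Icc_self hx)).derivWithin
        (uniqueDiffOn_Icc hγ.lt x (Ico_subset_Icc_self hx))) t ht

/-! ### The orthogonal sphere and plane. -/

lemma perpPlanes_orthogonal_singleton {U : Submodule ℝ E3} {v : E3} (hv : v ∈ U) :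
    PerpPlanes U (ℝ ∙ v)ᗮ := by
  rw [PerpPlanes, Submodule.orthogonal_orthogonal, Submodule.isOrtho_iff_le]
  exact Submodule.orthogonal_le ((Submodule.span_singleton_le_iff_mem _ _).2 hv)

theorem exists_meetsSphereOrthogonally (hF : IsSurfaceImmersion I F)
    (hγ : IsAnalyticCurve I F γ a b) (hl : IsLineOfCurvature I F γ a b)
    (hg : HasConstGeodesicCurvature I F γ a b c) (hc : c ≠ 0) :
    ∃ O : E3, MeetsSphereOrthogonally I F (γ '' Icc a b) O (1 / |c|) := by
  obtain ⟨V, hV⟩ := exists_conormal hF hγ hl hg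
  refine ⟨c⁻¹ • (V a + c • F (γ a)), ?_⟩
  rintro _ ⟨t, ht, rfl⟩
  obtain ⟨hn, hm, -, he⟩ := hV t ht
  have hsub : F (γ t) - c⁻¹ • (V a + c • F (γ a)) = -(c⁻¹ • V t) := by
    rw [← he, smul_add, inv_smul_smul₀ hc]
    abel
  rw [mem_sphere_iff_norm, hsub]
  refine ⟨?_, perpPlanes_orthogonal_singleton
    (Submodule.neg_mem _ (Submodule.smul_mem _ _ hm))⟩
  rw [norm_neg, norm_smul, hn, norm_inv, Real.norm_eq_abs, mul_one, one_div]

theorem exists_meetsPlaneOrthogonally (hF : IsSurfaceImmersion I F)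
    (hγ : IsAnalyticCurve I F γ a b) (hl : IsLineOfCurvature I F γ a b)
    (hg : HasConstGeodesicCurvature I F γ a b 0) :
    ∃ P : AffineSubspace ℝ E3, MeetsPlaneOrthogonally I F (γ '' Icc a b) P := by
  obtain ⟨V, hV⟩ := exists_conormal hF hγ hl hg
  simp only [zero_smul, add_zero] at hV
  have ha : a ∈ Icc a b := left_mem_Icc.2 hγ.lt.le
  have hVa : V a ≠ 0 := norm_ne_zero_iff.1 (by rw [(hV a ha).1]; exact one_ne_zero)
  have : Fact (Module.finrank ℝ E3 = 2 + 1) := ⟨by simp⟩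
  refine ⟨AffineSubspace.mk' (F (γ a)) (ℝ ∙ V a)ᗮ, ?_, ?_⟩
  · rw [AffineSubspace.direction_mk']
    exact Submodule.finrank_orthogonal_span_singleton hVa
  rintro _ ⟨t, ht, rfl⟩
  rw [AffineSubspace.direction_mk', AffineSubspace.mem_mk', vsub_eq_sub,
    Submodule.mem_orthogonal_singleton_iff_inner_right]
  have hd : ∀ x ∈ Icc a b, HasDerivWithinAt (fun x => ⟪V a, (F ∘ γ) x⟫_ℝ) 0 (Icc a b) x := by
    intro x hx
    have h := (hasDerivWithinAt_const x (Icc a b) (V a)).inner ℝ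
      (hγ.hasDerivWithinAt hF hx).differentiableWithinAt.hasDerivWithinAt
    -- Since `V` is constant, `V a` may be replaced by `V x`, which is perpendicular to `α'` at `x`.
    rwa [← (hV x hx).2.2.2, (hV x hx).2.2.1, inner_zero_left, add_zero,
      (hV x hx).2.2.2] at h
  have hconst := constant_of_derivWithin_zero (fun x hx => (hd x hx).differentiableWithinAt)
      (fun x hx => (hd x (Ico_subset_Icc_self hx)).derivWithin
        (uniqueDiffOn_Icc hγ.lt x (Ico_subset_Icc_self hx))) t ht
  refine ⟨?_, perpPlanes_orthogonal_singleton ((hV t ht).2.2.2 ▸ (hV t ht).2.1)⟩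
  rw [inner_sub_right]
  exact sub_eq_zero.2 hconst

end Surface

end SurfaceCurve

open SurfaceCurve in
theorem proposition3p3 {H : Type*} [TopologicalSpace H] (I : ModelWithCorners ℝ E2 H)
    {M : Type*} [TopologicalSpace M] [ChartedSpace H M] [IsManifold I 2 M]
    (F : M → E3) (hF : IsSurfaceImmersion I F) (γ : ℝ → M) (c : ℝ) :
    (∀ a b : ℝ, IsAnalyticCurve I F γ a b →
      IsLineOfCurvature I F γ a b →
      (flatPoints I F γ a b).Finite →
      HasConstGeodesicCurvature I F γ a b c →
        (c ≠ 0 → ∃ O : E3, MeetsSphereOrthogonally I F (γ '' Icc a b) O (1 / |c|)) ∧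
        (c = 0 → ∃ P : AffineSubspace ℝ E3, MeetsPlaneOrthogonally I F (γ '' Icc a b) P)) ∧
    (∀ (n : ℕ) (t : Fin (n + 1) → ℝ), IsPiecewiseAnalyticCurve I F γ t →
      (∀ i : Fin n, IsLineOfCurvature I F γ (t i.castSucc) (t i.succ)) →
      (∀ i : Fin n, (flatPoints I F γ (t i.castSucc) (t i.succ)).Finite) →
      (∀ i : Fin n, HasConstGeodesicCurvature I F γ (t i.castSucc) (t i.succ) c) →
        (c ≠ 0 → ∃ O : Fin n → E3, ∀ i : Fin n,
          MeetsSphereOrthogonally I F (γ '' Icc (t i.castSucc) (t i.succ)) (O i) (1 / |c|)) ∧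
        (c = 0 → ∃ P : Fin n → AffineSubspace ℝ E3, ∀ i : Fin n,
          MeetsPlaneOrthogonally I F (γ '' Icc (t i.castSucc) (t i.succ)) (P i))) := by
  refine ⟨fun a b hγ hl _ hg => ⟨fun hc => exists_meetsSphereOrthogonally hF hγ hl hg hc, ?_⟩,
    fun n t hγ hl _ hg => ⟨fun hc => ?_, ?_⟩⟩
  · rintro rfl
    exact exists_meetsPlaneOrthogonally hF hγ hl hg
  -- Each piece has its own centre, as the conormal may jump at a break point.
  · choose O hO using fun i =>
      exists_meetsSphereOrthogonally hF (hγ.piece i) (hl i) (hg i) hc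
    exact ⟨O, hO⟩
  · rintro rfl
    choose P hP using fun i => exists_meetsPlaneOrthogonally hF (hγ.piece i) (hl i) (hg i)
    exact ⟨P, hP⟩
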